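/- Let $k$ be a commutative ring. For finite sets $X,Y$ let $\mathcal C(Y,X)$ be the set of all subsets of $Y\times X$ (correspondences from $X$ to $Y$), with composition $RS=\{(z,x)\mid \exists y,\ (z,y)\in R,\ (y,x)\in S\}$; let $k\mathcal C$ be the $k$-linearization of the resulting category of finite sets and correspondences, and let $\mathcal F_k$ be the category of correspondence functors, i.e. of $k$-linear functors from $k\mathcal C$ to $k$-modules. For a finite lattice $T$ with least element $\hat 0$, let $F_T\in\mathcal F_k$ be the functor such that $F_T(X)$ is the free $k$-module on the set of all maps $X\to T$, where a correspondence $Q\in\mathcal C(Y,X)$ sends $\varphi:X\to T$ to the map $y\mapsto\bigvee_{(y,x)\in Q}\varphi(x)$ (an empty join being $\hat 0$). Let $H_T\subseteq F_T$ be the subfunctor such that $H_T(X)$ is generated by all $\varphi:X\to T$ whose image does not contain every join-irreducible element of $T$. For a finite set $E$, let $\mathcal P_E$ (the algebra of permuted orders) be the quotient of the algebra $k\mathcal C(E,E)$ by the two-sided ideal generated by all relations that factor through a set with fewer elements than $E$ and by all differences $S-\overline S$, where $S$ is a reflexive relation on $E$ and $\overline S$ its transitive closure. For an order relation $R$ on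 $E$, let $f_R=\sum_{S\supseteq R}\mu(R,S)\,S\in\mathcal P_E$, where $S$ runs through the order relations on $E$ containing $R$ and $\mu$ is the Möbius function of the set of all order relations on $E$, ordered by inclusion. Regard the left ideal $\mathcal P_Ef_R$ as a left $k\mathcal C(E,E)$-module. The fundamental functor of $(E,R)$ is $\mathbb S_{E,R}=L/J\in\mathcal F_k$, where $L(X)=k\mathcal C(X,E)\otimes_{k\mathcal C(E,E)}\mathcal P_Ef_R$ and $$J(X)=\Big\{\sum_i\varphi_i\otimes w_i\in L(X)\ \Big|\ \sum_i(\psi\varphi_i)\cdot w_i=0\ \text{ for all }\psi\in k\mathcal C(E,X)\Big\}.$$ **Theorem.** Let $n\ge 0$ be an integer, let $\underline n=\{0<1<\dots<n\}$ be the totally ordered lattice with $n+1$ elements, and let $\mathbb S_n=F_{\underline n}/H_{\underline n}$. 1. $\mathbb S_n$ is isomorphic, in $\mathcal F_k$, to the fundamental functor $\mathbb S_{[n],\mathrm{tot}}$, where $\mathrm{tot}$ is the usual total order on $[n]=\{1,\dots,n\}$. 2. For every finite set $X$, the $k$-module $\mathbb S_n(X)$ is free of rank $\displaystyle\sum_{i=0}^n(-1)^{n-i}\binom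 ni(i+1)^{|X|}$. -/

import Mathlib

open CategoryTheory TensorProduct

universe u w t e m

namespace CorrFun

/-! ### Correspondences -/

/-- The set `𝒞(Y, X)` of all correspondences from `X` to `Y`, i.e. all subsets of `Y × X`. -/
abbrev Corr (Y : Type*) (X : Type*) := Set (Y × X)

namespace Corr

/-- The composite `R S = {(z, x) | ∃ y, (z, y) ∈ R ∧ (y, x) ∈ S}`. -/
def comp {Z Y X : Type*} (R : Corr Z Y) (S : Corr Y X) : Corr Z X :=
  {p : Z × X | ∃ y : Y, (p.1, y) ∈ R ∧ (y, p.2) ∈ S}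

/-- The identity correspondence `Δ_X`. -/
def diag (X : Type*) : Corr X X := {p : X × X | p.1 = p.2}

theorem comp_assoc {A B C D : Type*} (R : Corr A B) (S : Corr B C) (T : Corr C D) :
    comp (comp R S) T = comp R (comp S T) := by
  apply Set.ext
  rintro ⟨a, d⟩
  constructor
  · rintro ⟨c, ⟨b, h1, h2⟩, h3⟩
    exact ⟨b, h1, c, h2, h3⟩
  · rintro ⟨b, h1, c, h2, h3⟩
    exact ⟨c, ⟨b, h1, h2⟩, h3⟩

theorem diag_comp {A B : Type*} (R : Corr A B) : comp (diag A) R = R := by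
  apply Set.ext
  rintro ⟨a, b⟩
  constructor
  · rintro ⟨c, h1, h2⟩
    obtain rfl : a = c := h1
    exact h2
  · intro h
    exact ⟨a, rfl, h⟩

theorem comp_diag {A B : Type*} (R : Corr A B) : comp R (diag B) = R := by
  apply Set.ext
  rintro ⟨a, b⟩
  constructor
  · rintro ⟨c, h1, h2⟩
    obtain rfl : c = b := h2
    exact h1
  · intro h
    exact ⟨b, h, rfl⟩

/-- The monoid `𝒞(E, E)` of all relations on `E`; its monoid algebra over `k` is `k𝒞(E, E)`. -/
instance (E : Type*) : Monoid (Corr E E) where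
  mul := comp
  one := diag E
  mul_assoc := comp_assoc
  one_mul := diag_comp
  mul_one := comp_diag

end Corr

/-- A finite set, as an object of the category `𝒞` of finite sets and correspondences. -/
structure FinCorr : Type (w + 1) where
  /-- the underlying type -/
  carrier : Type w
  [fintype : Fintype carrier]

instance : CoeSort FinCorr.{w} (Type w) := ⟨FinCorr.carrier⟩

instance (X : FinCorr.{w}) : Fintype X := X.fintype

/-- The category `𝒞`: the morphisms from `X` to `Y` are the elements of `𝒞(Y, X)`. -/
instance : Category FinCorr.{w} where
  Hom X Y := Corr Y X
  id X := Corr.diag X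
  comp f g := Corr.comp g f
  id_comp f := Corr.comp_diag f
  comp_id f := Corr.diag_comp f
  assoc f g h := (Corr.comp_assoc h g f).symm

/-- The category `ℱ_k` of correspondence functors: `k`-linear functors from the `k`-linearization
`k𝒞` of `𝒞` to `k`-modules. -/
abbrev CorrespondenceFunctor (k : Type u) [CommRing k] :=
  ObjectProperty.FullSubcategory
    (fun F : Free k FinCorr.{w} ⥤ ModuleCat.{m} k => F.Additive ∧ F.Linear k)

/-- The value `F(X)` of a correspondence functor at a finite set `X`. -/
abbrev CorrespondenceFunctor.eval {k : Type u} [CommRing k]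
    (F : CorrespondenceFunctor.{u, w, m} k) (X : FinCorr.{w}) : ModuleCat.{m} k :=
  F.obj.obj (Free.of k X)

/-- The `k`-linear extension to `k𝒞` of a functor defined on `𝒞`. -/
noncomputable def linearExtension {k : Type u} [CommRing k]
    (G : FinCorr.{w} ⥤ ModuleCat.{m} k) : CorrespondenceFunctor.{u, w, m} k where
  obj :=
    { obj := fun X => G.obj X
      map := fun {X Y} α =>
        Finsupp.linearCombination k
          (fun f : (show FinCorr.{w} from X) ⟶ (show FinCorr.{w} from Y) => G.map f) α
      map_id := fun X => by
        change Finsupp.linearCombination k _ (Finsupp.single _ (1 : k)) = _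
        rw [Finsupp.linearCombination_single, one_smul]
        exact G.map_id _
      map_comp := fun {X Y Z} α β => by
        induction α using Finsupp.induction_linear with
        | zero =>
          erw [Limits.zero_comp, map_zero, Limits.zero_comp]
        | add α₁ α₂ h₁ h₂ =>
          erw [Preadditive.add_comp, map_add, map_add, Preadditive.add_comp, h₁, h₂]
        | single f r =>
          induction β using Finsupp.induction_linear with
          | zero => erw [Limits.comp_zero, map_zero, Limits.comp_zero]
          | add β₁ β₂ h₁ h₂ =>
            erw [Preadditive.comp_add, map_add, map_add, Preadditive.comp_add, h₁, h₂]
          | single g s =>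
            erw [Free.single_comp_single, Finsupp.linearCombination_single,
              Finsupp.linearCombination_single, Finsupp.linearCombination_single]
            erw [G.map_comp, Linear.smul_comp, Linear.comp_smul, smul_smul] }
  property := by
    refine ⟨⟨?_⟩, ⟨?_⟩⟩
    · intro X Y α β
      exact map_add _ _ _
    · intro X Y α r
      exact map_smul _ _ _

/-- The quotient of a functor on `𝒞` by a subfunctor. -/
noncomputable def quotientFunctor {k : Type u} [CommRing k]
    (G : FinCorr.{w} ⥤ ModuleCat.{m} k) (N : ∀ X : FinCorr.{w}, Submodule k (G.obj X))
    (hN : ∀ (X Y : FinCorr.{w}) (f : X ⟶ Y), N X ≤ (N Y).comap (G.map f).hom) :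
    FinCorr.{w} ⥤ ModuleCat.{m} k where
  obj X := ModuleCat.of k (G.obj X ⧸ N X)
  map {X Y} f := ModuleCat.ofHom ((N X).mapQ (N Y) (G.map f).hom (hN X Y f))
  map_id X := by
    ext x
    simp
  map_comp {X Y Z} f g := by
    ext x
    simp

/-! ### The functor of a finite lattice -/

section Lattice

variable (k : Type u) [CommRing k] (T : Type t) [Lattice T] [OrderBot T]

open Classical in
/-- The map `φ ↦ Q φ`, where `(Q φ)(y)` is the join of all `φ(x)` with `(y, x) ∈ Q`. -/
noncomputable def act {Y X : FinCorr.{w}} (Q : Corr Y X) (φ : X → T) : Y → T := fun y =>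
  (Finset.univ.filter fun x : X => (y, x) ∈ Q).sup φ

theorem act_le_iff {Y X : FinCorr.{w}} (Q : Corr Y X) (φ : X → T) (y : Y) (a : T) :
    act T Q φ y ≤ a ↔ ∀ x : X, (y, x) ∈ Q → φ x ≤ a := by
  simp [act]

theorem act_diag {X : FinCorr.{w}} (φ : X → T) : act T (Corr.diag X) φ = φ := by
  funext y
  apply eq_of_forall_ge_iff
  intro a
  rw [act_le_iff]
  constructor
  · intro h
    exact h y rfl
  · intro h x hx
    obtain rfl : y = x := hx
    exact h

theorem act_comp {Z Y X : FinCorr.{w}} (R : Corr Z Y) (S : Corr Y X) (φ : X → T) :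
    act T (Corr.comp R S) φ = act T R (act T S φ) := by
  funext z
  apply eq_of_forall_ge_iff
  intro a
  simp only [act_le_iff]
  constructor
  · intro h y hy x hx
    exact h x ⟨y, hy, hx⟩
  · rintro h x ⟨y, hy, hx⟩
    exact h y hy x hx

/-- The functor `F_T` on `𝒞`: `F_T(X)` is the free module on the set of all maps `X → T`. -/
noncomputable def latticeFunctor : FinCorr.{w} ⥤ ModuleCat.{max w t u} k where
  obj X := ModuleCat.of k ((X → T) →₀ k)
  map {X Y} Q := ModuleCat.ofHom (Finsupp.lmapDomain k k (act T (show Corr Y X from Q)))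
  map_id X := by
    have h : act T (Corr.diag X) = id := funext fun φ => act_diag T φ
    change ModuleCat.ofHom (Finsupp.lmapDomain k k (act T (Corr.diag X))) = _
    rw [h, Finsupp.lmapDomain_id]
    rfl
  map_comp {X Y Z} f g := by
    have h : act T (Corr.comp (show Corr Z Y from g) (show Corr Y X from f)) =
        act T (show Corr Z Y from g) ∘ act T (show Corr Y X from f) :=
      funext fun φ => act_comp T _ _ φ
    change ModuleCat.ofHom (Finsupp.lmapDomain k k (act T (Corr.comp _ _))) = _
    rw [h, Finsupp.lmapDomain_comp]
    rfl

/-- `H_T(X)`: the submodule of `F_T(X)` generated by all `φ : X → T` whose image does not contain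
all (join-)irreducible elements of `T`. -/
noncomputable def latticeSub (X : FinCorr.{w}) : Submodule k ((latticeFunctor k T).obj X) :=
  Submodule.span k
    {v : (X → T) →₀ k | ∃ φ : X → T, ¬ {a : T | SupIrred a} ⊆ Set.range φ ∧
      v = Finsupp.single φ 1}

theorem latticeSub_le (X Y : FinCorr.{w}) (f : X ⟶ Y) :
    latticeSub k T X ≤ (latticeSub k T Y).comap ((latticeFunctor k T).map f).hom := by
  classical
  refine Submodule.span_le.2 ?_
  rintro v ⟨φ, hφ, rfl⟩
  refine Submodule.subset_span ⟨act T (show Corr Y X from f) φ, fun h => hφ ?_, ?_⟩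
  · intro a ha
    obtain ⟨y, hy⟩ := h ha
    obtain ⟨x, -, hx⟩ := SupIrred.finset_sup_eq ha hy
    exact ⟨x, hx⟩
  · exact Finsupp.mapDomain_single

/-- The correspondence functor `F_T / H_T`. -/
noncomputable def latticeQuotient : CorrespondenceFunctor.{u, w, max w t u} k :=
  linearExtension (quotientFunctor (latticeFunctor k T) (latticeSub k T) (latticeSub_le k T))

end Lattice

/-- The correspondence functor `𝕊_n = F_n / H_n` of the totally ordered lattice
`{0 < 1 < ⋯ < n}`. -/
noncomputable def totalS (k : Type u) [CommRing k] (n : ℕ) : CorrespondenceFunctor.{u, w, max w u} k :=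
  latticeQuotient k (Fin (n + 1))

/-! ### The fundamental module of a finite poset -/

/-- The order relations on a set `E`. -/
def OrderRel (E : Type e) :=
  {R : Corr E E // (∀ a, (a, a) ∈ R) ∧ (∀ a b, (a, b) ∈ R → (b, a) ∈ R → a = b) ∧
    ∀ a b c, (a, b) ∈ R → (b, c) ∈ R → (a, c) ∈ R}

namespace OrderRel

/-- The underlying relation. -/
def rel {E : Type e} (R : OrderRel E) : Corr E E := R.1

/-- Order relations are themselves ordered by inclusion. -/
instance (E : Type e) : PartialOrder (OrderRel E) := Subtype.partialOrder _

instance (E : Type e) [Finite E] : Finite (OrderRel E) := Subtype.finite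

noncomputable instance (E : Type e) [Finite E] : Fintype (OrderRel E) := Fintype.ofFinite _

open Classical in
noncomputable instance (E : Type e) [Finite E] : LocallyFiniteOrder (OrderRel E) :=
  Fintype.toLocallyFiniteOrder

/-- The order relation of a poset, `(a, b) ∈ R` if and only if `a ≤ b`. -/
def ofLE (E : Type e) [PartialOrder E] : OrderRel E :=
  ⟨{p | p.1 ≤ p.2}, fun a => le_refl a, fun _ _ h h' => le_antisymm h h',
    fun _ _ _ h h' => le_trans h h'⟩

end OrderRel

/-- A relation on `E` is inessential if it factors through a set with fewer elements than `E`. -/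
def Inessential {E : Type e} (Q : Corr E E) : Prop :=
  ∃ (Y : Type) (_ : Finite Y) (A : Corr E Y) (B : Corr Y E),
    Nat.card Y < Nat.card E ∧ Q = Corr.comp A B

/-- The transitive closure of a relation. -/
def transClosure {E : Type e} (S : Corr E E) : Corr E E :=
  {p : E × E | Relation.TransGen (fun a b => (a, b) ∈ S) p.1 p.2}

/-- The relations imposed on `k𝒞(E, E)` to obtain the algebra of permuted orders. -/
inductive PermutedRel (k : Type u) [CommRing k] (E : Type e) :
    MonoidAlgebra k (Corr E E) → MonoidAlgebra k (Corr E E) → Prop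
  | inessential (Q : Corr E E) (hQ : Inessential Q) :
      PermutedRel k E (MonoidAlgebra.of k (Corr E E) Q) 0
  | closure (S : Corr E E) (hS : ∀ a : E, (a, a) ∈ S) :
      PermutedRel k E (MonoidAlgebra.of k (Corr E E) S)
        (MonoidAlgebra.of k (Corr E E) (transClosure S))

/-- The algebra `𝒫_E` of permuted orders: the quotient of the algebra `k𝒞(E, E)` of relations on `E`
by the two-sided ideal generated by the inessential relations (which gives the essential algebra)
and by the differences `S - S̄`, where `S` is reflexive with transitive closure `S̄`. It has the
classes of the relations `Δ_σ R` as a basis, for `σ` a permutation and `R` an order, and the product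
of two orders is the transitive closure of their union if that is an order, and zero otherwise. -/
abbrev PermutedOrders (k : Type u) [CommRing k] (E : Type e) := RingQuot (PermutedRel k E)

section Fundamental

variable (k : Type u) [CommRing k] {E : Type e} [Finite E]

/-- The class in `𝒫_E` of a relation on `E`. -/
noncomputable def permutedClass (E : Type e) : Corr E E →* PermutedOrders k E :=
  ((RingQuot.mkAlgHom k (PermutedRel k E) :
    MonoidAlgebra k (Corr E E) →ₐ[k] PermutedOrders k E) :
      MonoidAlgebra k (Corr E E) →* PermutedOrders k E).comp (MonoidAlgebra.of k (Corr E E))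

open Classical in
/-- The idempotent `f_R = ∑ μ(R, S) S` of `𝒫_E`, where `S` runs through the orders on `E` containing
`R` and `μ` is the Möbius function of the set of all orders on `E`, ordered by inclusion. -/
noncomputable def fElement (R : OrderRel E) : PermutedOrders k E :=
  ∑ S : OrderRel E with R ≤ S, IncidenceAlgebra.mu k R S • permutedClass k E S.rel

/-- The fundamental module `𝒫_E f_R`, the left ideal of `𝒫_E` generated by `f_R`. -/
noncomputable abbrev fundamentalModule (R : OrderRel E) : Ideal (PermutedOrders k E) :=
  Ideal.span {fElement k R}

/-- The fundamental module `𝒫_E f_R` as a left module over `k𝒞(E, E)`, via `k𝒞(E, E) → 𝒫_E`. -/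
noncomputable def fundamentalRep (R : OrderRel E) :
    Representation k (Corr E E) (fundamentalModule k R) :=
  ((Algebra.lsmul k k (fundamentalModule k R) :
    PermutedOrders k E →ₐ[k] Module.End k (fundamentalModule k R)) :
      PermutedOrders k E →* Module.End k (fundamentalModule k R)).comp (permutedClass k E)

end Fundamental

/-! ### The functors `L_{E,W}` and `L_{E,W} / J_{E,W}` -/

section LJ

variable {k : Type u} [CommRing k] {E : Type e} {W : Type t} [AddCommGroup W] [Module k W]
  (ρ : Representation k (Corr E E) W)

/-- The relations defining the tensor product `k𝒞(X, E) ⊗ W` over `k𝒞(E, E)` as a quotient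
of the tensor product over the commutative ring `k`, namely `φ Q ⊗ v = φ ⊗ Q v`. (Over `k`, we write
the factor `W` first.) -/
noncomputable def balanced (X : Type w) : Submodule k (W ⊗[k] (Corr X E →₀ k)) :=
  Submodule.span k {z | ∃ (φ : Corr X E) (Q : Corr E E) (v : W),
    z = v ⊗ₜ[k] Finsupp.single (Corr.comp φ Q) (1 : k) - ρ Q v ⊗ₜ[k] Finsupp.single φ (1 : k)}

/-- `L_{E,W}(X) = k𝒞(X, E) ⊗ W`, the tensor product being over `k𝒞(E, E)`; the left
`k𝒞(E, E)`-module `W` is given by the action `ρ` of the monoid `𝒞(E, E)`. -/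
noncomputable abbrev LModule (X : Type w) := (W ⊗[k] (Corr X E →₀ k)) ⧸ balanced ρ X

/-- The action of `Q ∈ 𝒞(Y, X)`, which maps `φ ⊗ v` to `Q φ ⊗ v`. -/
noncomputable def LMap {X Y : Type w} (Q : Corr Y X) : LModule ρ X →ₗ[k] LModule ρ Y :=
  (balanced ρ X).mapQ (balanced ρ Y)
    (LinearMap.lTensor W (Finsupp.lmapDomain k k (fun φ : Corr X E => Corr.comp Q φ))) (by
      refine Submodule.span_le.2 ?_
      rintro z ⟨φ, P, v, rfl⟩
      refine Submodule.subset_span ⟨Corr.comp Q φ, P, v, ?_⟩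
      simp [Finsupp.mapDomain_single, Corr.comp_assoc])

theorem LMap_mk {X Y : Type w} (Q : Corr Y X) (v : W) (φ : Corr X E) (c : k) :
    LMap ρ Q (Submodule.Quotient.mk (v ⊗ₜ[k] Finsupp.single φ c)) =
      Submodule.Quotient.mk (v ⊗ₜ[k] Finsupp.single (Corr.comp Q φ) c) := by
  change Submodule.Quotient.mk (LinearMap.lTensor W
    (Finsupp.lmapDomain k k (fun φ : Corr X E => Corr.comp Q φ)) (v ⊗ₜ[k] Finsupp.single φ c)) = _
  simp [Finsupp.mapDomain_single]

theorem LModule_hom_ext {X : Type w} {M : Type*} [AddCommGroup M] [Module k M]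
    {f g : LModule ρ X →ₗ[k] M}
    (h : ∀ (v : W) (φ : Corr X E), f (Submodule.Quotient.mk (v ⊗ₜ[k] Finsupp.single φ 1)) =
      g (Submodule.Quotient.mk (v ⊗ₜ[k] Finsupp.single φ 1))) : f = g := by
  apply Submodule.linearMap_qext
  apply TensorProduct.ext
  apply LinearMap.ext
  intro v
  apply Finsupp.lhom_ext'
  intro φ
  apply LinearMap.ext_ring
  exact h v φ

theorem LMap_diag (X : Type w) : LMap ρ (Corr.diag X) = LinearMap.id :=
  LModule_hom_ext ρ fun v φ => by rw [LMap_mk, Corr.diag_comp]; rfl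

theorem LMap_comp {X Y Z : Type w} (Q : Corr Z Y) (P : Corr Y X) :
    LMap ρ (Corr.comp Q P) = LMap ρ Q ∘ₗ LMap ρ P :=
  LModule_hom_ext ρ fun v φ => by
    rw [LMap_mk, LinearMap.comp_apply, LMap_mk, LMap_mk, Corr.comp_assoc]

/-- For `ψ ∈ 𝒞(E, X)`, the map `L_{E,W}(X) → W` with `φ ⊗ v ↦ (ψ φ) · v`. -/
noncomputable def pairing {X : Type w} (ψ : Corr E X) : LModule ρ X →ₗ[k] W :=
  (balanced ρ X).liftQ
    (TensorProduct.lift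
      (Finsupp.linearCombination k (fun φ : Corr X E => ρ (Corr.comp ψ φ))).flip) (by
      refine Submodule.span_le.2 ?_
      rintro z ⟨φ, P, v, rfl⟩
      have h : ρ (Corr.comp ψ (Corr.comp φ P)) = ρ (Corr.comp ψ φ) * ρ P := by
        rw [← Corr.comp_assoc]
        exact map_mul ρ (Corr.comp ψ φ) P
      simp [h])

theorem pairing_mk {X : Type w} (ψ : Corr E X) (v : W) (φ : Corr X E) :
    pairing ρ ψ (Submodule.Quotient.mk (v ⊗ₜ[k] Finsupp.single φ 1)) =
      ρ (Corr.comp ψ φ) v := by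
  change TensorProduct.lift (Finsupp.linearCombination k
    (fun φ : Corr X E => ρ (Corr.comp ψ φ))).flip (v ⊗ₜ[k] Finsupp.single φ 1) = _
  simp

theorem pairing_comp {X Y : Type w} (ψ : Corr E Y) (Q : Corr Y X) :
    pairing ρ ψ ∘ₗ LMap ρ Q = pairing ρ (Corr.comp ψ Q) :=
  LModule_hom_ext ρ fun v φ => by
    rw [LinearMap.comp_apply, LMap_mk, pairing_mk, pairing_mk, Corr.comp_assoc]

/-- `L_{E,W}` as a functor on `𝒞`. -/
noncomputable def LFunctor : FinCorr.{w} ⥤ ModuleCat.{max w (max e t) u} k where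
  obj X := ModuleCat.of k (LModule ρ X)
  map {X Y} Q := ModuleCat.ofHom (LMap ρ (show Corr Y X from Q))
  map_id X := by
    rw [show (show Corr X X from 𝟙 X) = Corr.diag X from rfl, LMap_diag]
    rfl
  map_comp {X Y Z} f g := by
    rw [show (show Corr Z X from f ≫ g) = Corr.comp (show Corr Z Y from g) (show Corr Y X from f)
      from rfl, LMap_comp]
    rfl

/-- `J_{E,W}(X)`: all `∑ φᵢ ⊗ vᵢ` such that `∑ (α φᵢ) · vᵢ = 0` for all `α ∈ k𝒞(E, X)`. -/
noncomputable def JModule (X : Type w) : Submodule k (LModule ρ X) :=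
  ⨅ α : Corr E X →₀ k,
    LinearMap.ker (Finsupp.linearCombination k (fun ψ : Corr E X => pairing ρ ψ) α)

theorem mem_JModule {X : Type w} (z : LModule ρ X) :
    z ∈ JModule ρ X ↔ ∀ ψ : Corr E X, pairing ρ ψ z = 0 := by
  rw [JModule, Submodule.mem_iInf]
  constructor
  · intro h ψ
    have h' := h (Finsupp.single ψ 1)
    rwa [Finsupp.linearCombination_single, one_smul] at h'
  · intro h α
    rw [LinearMap.mem_ker, Finsupp.linearCombination_apply, Finsupp.sum, LinearMap.sum_apply]
    refine Finset.sum_eq_zero fun ψ _ => ?_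
    rw [LinearMap.smul_apply, h, smul_zero]

theorem JModule_le {X Y : Type w} (Q : Corr Y X) :
    JModule ρ X ≤ (JModule ρ Y).comap (LMap ρ Q) := by
  intro z hz
  rw [Submodule.mem_comap, mem_JModule]
  intro ψ
  rw [← LinearMap.comp_apply, pairing_comp]
  exact (mem_JModule ρ z).1 hz _

/-- The correspondence functor `L_{E,W} / J_{E,W}`. -/
noncomputable def LJQuotient : CorrespondenceFunctor.{u, w, max w (max e t) u} k :=
  linearExtension (quotientFunctor (LFunctor ρ) (fun X => JModule ρ X)
    (fun _ _ f => JModule_le ρ f))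

end LJ

/-- The fundamental functor `𝕊_{E,R}` of a finite poset `(E, R)`. -/
noncomputable def fundamentalFunctor (k : Type u) [CommRing k] {E : Type e} [Finite E]
    (R : OrderRel E) : CorrespondenceFunctor.{u, w, max w e u} k :=
  LJQuotient (W := fundamentalModule k R) (fundamentalRep k R)

/-- The total order on `[n] = {1, …, n}`. -/
def totalOrder (n : ℕ) : OrderRel (Set.Icc 1 n) := OrderRel.ofLE (Set.Icc 1 n)

end CorrFun

/-!
Evaluating `F_T / H_T` at `[n]`, for `T = {0 < 1 < ⋯ < n}`, recovers the fundamental module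
`𝒫_E f_R`: as the total order is maximal, `f_R` is its class in `𝒫_E`; it corresponds to the
decreasing enumeration `γ` of the join-irreducible elements, and a map `α : [n] → T` corresponds to
the class of the relation `γ(e) ≤ α(x)`, whose action sends `γ` to `α`.

A functor `G` on `𝒞` is of the form `L_{E,W} / J_{E,W}` if it is generated by elements `φ · w` with
`w ∈ W` and separated by maps to `W` sending `φ · w` to `(ψ φ) · w`. Every `α : X → T` is obtained
from `γ` by a relation, so `F_T / H_T` is generated by its value at `[n]`. For the separation, a
correspondence `ψ` from `X` to `[n]` is a family of subsets `A_e` of `X`, and whether `ψ α = γ` can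
be decided for each `e` from the containments of `A_e` in `{α ≤ γ(e)}` and `{α < γ(e)}`; Möbius
inversion on the subsets of `X` then yields a combination of correspondences which detects the
coefficient of a single map. The maps which hit all of `1, …, n` form a basis of `F_T(X) / H_T(X)`,
and are counted by inclusion-exclusion.
-/

namespace CorrFun

section JoinAct

open Classical in
/-- The action of correspondences on maps to a join-semilattice, `(Q φ)(y) = ⋁_{(y, x) ∈ Q} φ(x)`.
Unlike in `act`, the finite sets involved may live in different universes: this is needed to let
correspondences between an object `X` of `𝒞` and the poset `E` act. -/
noncomputable def joinAct {T : Type*} [SemilatticeSup T] [OrderBot T] {Y X : Type*} [Fintype X]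
    (Q : Corr Y X) (φ : X → T) : Y → T := fun y =>
  (Finset.univ.filter fun x : X => (y, x) ∈ Q).sup φ

section Semilattice

variable {T : Type*} [SemilatticeSup T] [OrderBot T] {X Y Z : Type*} [Fintype X]

theorem joinAct_apply_le_iff {Q : Corr Y X} {φ : X → T} {y : Y} {a : T} :
    joinAct Q φ y ≤ a ↔ ∀ x, (y, x) ∈ Q → φ x ≤ a := by
  simp [joinAct]

theorem le_joinAct_apply {Q : Corr Y X} {y : Y} {x : X} (h : (y, x) ∈ Q) (φ : X → T) :
    φ x ≤ joinAct Q φ y :=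
  joinAct_apply_le_iff.1 le_rfl x h

theorem joinAct_comp [Fintype Y] (R : Corr Z Y) (S : Corr Y X) (φ : X → T) :
    joinAct (Corr.comp R S) φ = joinAct R (joinAct S φ) := by
  funext z
  refine eq_of_forall_ge_iff fun a => ?_
  simp only [joinAct_apply_le_iff]
  exact ⟨fun h y hy x hx => h x ⟨y, hy, hx⟩, fun h x ⟨y, hy, hx⟩ => h y hy x hx⟩

theorem le_joinAct_of_refl {S : Corr X X} (hS : ∀ a, (a, a) ∈ S) (φ : X → T) :
    φ ≤ joinAct S φ :=
  fun a => le_joinAct_apply (hS a) φ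

theorem joinAct_eq_self_iff {S : Corr X X} (hS : ∀ a, (a, a) ∈ S) {φ : X → T} :
    joinAct S φ = φ ↔ ∀ a b, (a, b) ∈ S → φ b ≤ φ a := by
  rw [← (le_joinAct_of_refl hS φ).ge_iff_eq']
  exact forall_congr' fun a => joinAct_apply_le_iff

theorem joinAct_transClosure_eq_self_iff {S : Corr X X} (hS : ∀ a, (a, a) ∈ S) {φ : X → T} :
    joinAct (transClosure S) φ = φ ↔ joinAct S φ = φ := by
  rw [joinAct_eq_self_iff hS, joinAct_eq_self_iff fun a => .single (hS a)]
  refine ⟨fun h a b hab => h a b (.single hab), fun h a b (hab : Relation.TransGen _ a b) => ?_⟩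
  induction hab with
  | single hab => exact h _ _ hab
  | tail _ hbc ih => exact (h _ _ hbc).trans ih

/-- The correspondence with prescribed sections `{x | (y, x) ∈ Q}`, which encodes correspondences
as families indexed by `Y`. -/
def Corr.ofSections (A : Y → Finset X) : Corr Y X := {p | p.2 ∈ A p.1}

theorem joinAct_ofSections (A : Y → Finset X) (φ : X → T) (y : Y) :
    joinAct (Corr.ofSections A) φ y = (A y).sup φ :=
  eq_of_forall_ge_iff fun _ => by
    rw [joinAct_apply_le_iff, Finset.sup_le_iff]
    rfl

end Semilattice

end JoinAct

section Covers

variable {T : Type*} [SemilatticeSup T] {X Y : Type*}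

/-- The maps to a join-semilattice which hit all its join-irreducible elements. The other maps
generate `H_T`. -/
def CoversSupIrred (α : X → T) : Prop := {a : T | SupIrred a} ⊆ Set.range α

theorem CoversSupIrred.of_joinAct [OrderBot T] [Fintype X] {Q : Corr Y X} {α : X → T}
    (h : CoversSupIrred (joinAct Q α)) : CoversSupIrred α := by
  intro a ha
  obtain ⟨y, hy⟩ := h ha
  obtain ⟨x, -, hx⟩ := SupIrred.finset_sup_eq ha hy
  exact ⟨x, hx⟩

theorem CoversSupIrred.ncard_le [Finite X] {α : X → T} (h : CoversSupIrred α) :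
    {a : T | SupIrred a}.ncard ≤ Nat.card X :=
  (Set.ncard_le_ncard h).trans (Set.image_univ (f := α) ▸
    (Set.ncard_image_le Set.finite_univ).trans (Set.ncard_univ X).le)

theorem CoversSupIrred.range_eq [Finite X] {α : X → T} (h : CoversSupIrred α)
    (hX : Nat.card X ≤ {a : T | SupIrred a}.ncard) : Set.range α = {a | SupIrred a} := by
  refine (Set.eq_of_subset_of_ncard_le h ?_).symm
  rw [← Set.image_univ]
  exact (Set.ncard_image_le Set.finite_univ).trans ((Set.ncard_univ X).trans_le hX)

theorem CoversSupIrred.injective [Finite X] {α : X → T} (h : CoversSupIrred α)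
    (hX : Nat.card X ≤ {a : T | SupIrred a}.ncard) : Function.Injective α := by
  rw [← Set.injOn_univ, ← Set.ncard_image_iff, Set.image_univ, h.range_eq hX, Set.ncard_univ]
  exact h.ncard_le.antisymm hX

/-- If `σ` has order `m > 0`, then `α ≤ α ∘ σ ≤ α ∘ σ ^ 2 ≤ ⋯ ≤ α ∘ σ ^ m = α`. -/
theorem comp_perm_eq_of_le {E P : Type*} [Finite E] [PartialOrder P] {α : E → P}
    {σ : Equiv.Perm E} (h : α ≤ α ∘ σ) : α ∘ σ = α := by
  have le_iterate (x : E) : Monotone fun i : ℕ => α ((σ ^ i) x) :=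
    monotone_nat_of_le_succ fun i => by
      rw [pow_succ', Equiv.Perm.mul_apply]
      exact h _
  refine le_antisymm (fun x => ?_) h
  simpa [pow_orderOf_eq_one] using le_iterate x (Nat.one_le_iff_ne_zero.2 (orderOf_pos σ).ne')

theorem eq_of_le_of_range_eq {E P : Type*} [Finite E] [PartialOrder P] {α β : E → P}
    (hα : Function.Injective α) (hβ : Function.Injective β) (hr : Set.range α = Set.range β)
    (h : α ≤ β) : α = β := by
  let σ : Equiv.Perm E :=
    (Equiv.ofInjective β hβ).trans ((Equiv.setCongr hr.symm).trans (Equiv.ofInjective α hα).symm)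
  have hσ : α ∘ σ = β := funext fun x => Equiv.apply_ofInjective_symm hα _
  rw [← hσ, comp_perm_eq_of_le (hσ ▸ h)]

theorem joinAct_eq_self_of_coversSupIrred [OrderBot T] [Fintype X]
    (hX : Nat.card X ≤ {a : T | SupIrred a}.ncard) {S : Corr X X} (hS : ∀ a, (a, a) ∈ S)
    {α : X → T} (h : CoversSupIrred (joinAct S α)) : joinAct S α = α :=
  have hα := h.of_joinAct
  (eq_of_le_of_range_eq (hα.injective hX) (h.injective hX)
    ((hα.range_eq hX).trans (h.range_eq hX).symm) (le_joinAct_of_refl hS α)).symm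

end Covers

section LatticeQuot

variable (k : Type*) [CommRing k] {T : Type*} [SemilatticeSup T] {X Y Z : Type*}

variable (T X) in
/-- The module `F_T(X) / H_T(X)`, for a type `X` in an arbitrary universe. -/
abbrev LatticeQuot : Type _ :=
  ((X → T) →₀ k) ⧸ Finsupp.supported k k {α : X → T | ¬ CoversSupIrred α}

/-- The class of a map `X → T` in `F_T(X) / H_T(X)`. -/
noncomputable def LatticeQuot.of (α : X → T) : LatticeQuot k T X :=
  Submodule.Quotient.mk (Finsupp.single α 1)

variable {k}

theorem LatticeQuot.of_eq_zero {α : X → T} (h : ¬ CoversSupIrred α) : of k α = 0 :=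
  (Submodule.Quotient.mk_eq_zero _).2 (Finsupp.single_mem_supported k 1 h)

theorem LatticeQuot.hom_ext {M : Type*} [AddCommGroup M] [Module k M]
    {f g : LatticeQuot k T X →ₗ[k] M} (h : ∀ α, f (of k α) = g (of k α)) : f = g :=
  Submodule.linearMap_qext _ <| Finsupp.lhom_ext' fun α => LinearMap.ext_ring (h α)

theorem supported_not_coversSupIrred :
    Finsupp.supported k k {α : X → T | ¬ CoversSupIrred α} =
      LinearMap.ker (Finsupp.lsubtypeDomain (M := k) (R := k) {α : X → T | CoversSupIrred α}) := by
  ext v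
  rw [Finsupp.mem_supported', LinearMap.mem_ker, Finsupp.ext_iff]
  simp only [Set.mem_ofPred_eq, not_not, Subtype.forall]
  rfl

open Classical in
variable (k T X) in
/-- The classes of the maps which hit all join-irreducible elements form a basis of
`F_T(X) / H_T(X)`. -/
noncomputable def LatticeQuot.basis :
    Module.Basis {α : X → T // CoversSupIrred α} k (LatticeQuot k T X) :=
  .ofRepr <| (Submodule.quotEquivOfEq _ _ supported_not_coversSupIrred).trans <|
    LinearMap.quotKerEquivOfSurjective _ fun v =>
      ⟨v.extendDomain, Finsupp.subtypeDomain_extendDomain v⟩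

open Classical in
theorem LatticeQuot.basis_coord_of (α : {α : X → T // CoversSupIrred α}) (β : X → T) :
    (basis k T X).coord α (of k β) = if β = α then 1 else 0 :=
  Finsupp.single_apply

section JoinMap

variable [OrderBot T] [Fintype X]

variable (k T) in
/-- The map `F_T(X) / H_T(X) → F_T(Y) / H_T(Y)` induced by a correspondence from `X` to `Y`. -/
noncomputable def joinMap (Q : Corr Y X) : LatticeQuot k T X →ₗ[k] LatticeQuot k T Y :=
  Submodule.mapQ _ _ (Finsupp.lmapDomain k k (joinAct Q)) <| by
    rw [Finsupp.supported_eq_span_single, Submodule.span_le]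
    rintro _ ⟨α, hα, rfl⟩
    simpa using Finsupp.single_mem_supported k 1 (mt CoversSupIrred.of_joinAct hα)

theorem joinMap_of (Q : Corr Y X) (α : X → T) :
    joinMap k T Q (.of k α) = .of k (joinAct Q α) :=
  congrArg Submodule.Quotient.mk Finsupp.mapDomain_single

theorem joinMap_comp [Fintype Y] (R : Corr Z Y) (S : Corr Y X) :
    joinMap k T (Corr.comp R S) = joinMap k T R ∘ₗ joinMap k T S :=
  LatticeQuot.hom_ext fun α => by
    simp only [LinearMap.comp_apply, joinMap_of, joinAct_comp]

theorem joinMap_diag : joinMap k T (Corr.diag X) = LinearMap.id :=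
  LatticeQuot.hom_ext fun α => by
    rw [joinMap_of, (joinAct_eq_self_iff fun _ => rfl).2 fun _ _ h => (congrArg α h).ge]
    rfl

variable (k T X) in
/-- `F_T(X) / H_T(X)` as a module over the monoid of relations on `X`. -/
noncomputable def joinRep : Representation k (Corr X X) (LatticeQuot k T X) where
  toFun Q := joinMap k T Q
  map_one' := joinMap_diag
  map_mul' := joinMap_comp

end JoinMap

end LatticeQuot

section PermutedOrders

theorem Inessential.of_card_lt {E Y : Type*} [Finite Y] (h : Nat.card Y < Nat.card E)
    (A : Corr E Y) (B : Corr Y E) : Inessential (Corr.comp A B) := by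
  let f := Finite.equivFin Y
  refine ⟨Fin (Nat.card Y), inferInstance, {p | (p.1, f.symm p.2) ∈ A}, {p | (f.symm p.1, p.2) ∈ B},
    by simpa using h, ?_⟩
  ext p
  exact f.symm.surjective.exists

section Class

variable (k : Type u) [CommRing k] {E : Type e}

theorem permutedClass_eq_zero {Q : Corr E E} (hQ : Inessential Q) : permutedClass k E Q = 0 :=
  (RingQuot.mkAlgHom_rel k (PermutedRel.inessential Q hQ)).trans (map_zero _)

variable {k}

theorem PermutedOrders.hom_ext {M : Type*} [AddCommGroup M] [Module k M]
    {f g : PermutedOrders k E →ₗ[k] M}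
    (h : ∀ Q, f (permutedClass k E Q) = g (permutedClass k E Q)) : f = g := by
  have hfg : f ∘ₗ (RingQuot.mkAlgHom k (PermutedRel k E)).toLinearMap =
      g ∘ₗ (RingQuot.mkAlgHom k (PermutedRel k E)).toLinearMap :=
    MonoidAlgebra.lhom_ext' fun Q => LinearMap.ext_ring (h Q)
  ext a
  obtain ⟨a, rfl⟩ := RingQuot.mkAlgHom_surjective k (PermutedRel k E) a
  exact LinearMap.congr_fun hfg a

end Class

section Action

variable (k : Type u) [CommRing k] {T : Type*} [SemilatticeSup T] [OrderBot T]
  {E : Type e} [Fintype E]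

theorem joinRep_inessential (hE : Nat.card E ≤ {a : T | SupIrred a}.ncard) {Q : Corr E E}
    (hQ : Inessential Q) : joinRep k T E Q = 0 := by
  obtain ⟨Y, _, A, B, hY, rfl⟩ := hQ
  have := Fintype.ofFinite Y
  refine LatticeQuot.hom_ext fun α => ?_
  rw [LinearMap.zero_apply]
  refine (joinMap_of _ α).trans (LatticeQuot.of_eq_zero fun h => ?_)
  rw [joinAct_comp] at h
  exact hY.not_ge (hE.trans h.of_joinAct.ncard_le)

theorem joinRep_transClosure (hE : Nat.card E ≤ {a : T | SupIrred a}.ncard) {S : Corr E E}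
    (hS : ∀ a, (a, a) ∈ S) : joinRep k T E S = joinRep k T E (transClosure S) := by
  refine LatticeQuot.hom_ext fun α => ?_
  refine (joinMap_of _ α).trans (Eq.trans ?_ (joinMap_of _ α).symm)
  have hS' : ∀ a, (a, a) ∈ transClosure S := fun a => .single (hS a)
  by_cases h : joinAct S α = α
  · rw [h, (joinAct_transClosure_eq_self_iff hS).2 h]
  · rw [LatticeQuot.of_eq_zero (mt (joinAct_eq_self_of_coversSupIrred hE hS) h),
      LatticeQuot.of_eq_zero (mt (joinAct_eq_self_of_coversSupIrred hE hS')
        (mt (joinAct_transClosure_eq_self_iff hS).1 h))]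

variable (T) in
/-- The action of the algebra of permuted orders on `F_T(E) / H_T(E)`, where `E` has no more
elements than there are join-irreducible elements in `T`. -/
noncomputable def permutedRep (hE : Nat.card E ≤ {a : T | SupIrred a}.ncard) :
    PermutedOrders k E →ₐ[k] Module.End k (LatticeQuot k T E) :=
  RingQuot.liftAlgHom k ⟨MonoidAlgebra.lift k _ _ (joinRep k T E), fun x y hxy => by
    cases hxy with
    | inessential Q hQ => simp [joinRep_inessential k hE hQ]
    | closure S hS => simp [joinRep_transClosure k hE hS]⟩

theorem permutedRep_permutedClass (hE : Nat.card E ≤ {a : T | SupIrred a}.ncard) (Q : Corr E E) :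
    permutedRep k T hE (permutedClass k E Q) = joinMap k T Q := by
  change RingQuot.liftAlgHom k _ (RingQuot.mkAlgHom k _ (MonoidAlgebra.of k _ Q)) = _
  rw [RingQuot.liftAlgHom_mkAlgHom_apply, MonoidAlgebra.lift_of]
  rfl

end Action

end PermutedOrders

section LevelCorr

/-- The correspondence `{(x, e) | γ(e) ≤ α(x)}` from `E` to `X`, which recovers `α` by its action on
`γ` if `γ` hits all join-irreducible elements. -/
def levelCorr {E X T : Type*} [LE T] (γ : E → T) (α : X → T) : Corr X E := {p | γ p.2 ≤ α p.1}

theorem joinAct_levelCorr {E X T : Type*} [SemilatticeSup T] [OrderBot T] [WellFoundedLT T]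
    [Fintype E] {γ : E → T} (hγ : CoversSupIrred γ) (α : X → T) :
    joinAct (levelCorr γ α) γ = α := by
  funext x
  refine le_antisymm (joinAct_apply_le_iff.2 fun _ h => h) ?_
  obtain ⟨s, hs, hirr⟩ := exists_supIrred_decomposition (α x)
  conv_lhs => rw [← hs]
  refine Finset.sup_le fun a ha => ?_
  obtain ⟨e, rfl⟩ := hγ (hirr ha)
  exact le_joinAct_apply ((Finset.le_sup (f := id) ha).trans hs.le :) γ

theorem le_joinAct_apply_iff {X Y T : Type*} [SemilatticeSup T] [OrderBot T] [Fintype X]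
    {Q : Corr Y X} {φ : X → T} {y : Y} {a : T} (ha : SupPrime a) :
    a ≤ joinAct Q φ y ↔ ∃ x, (y, x) ∈ Q ∧ a ≤ φ x := by
  simp [joinAct, ha.le_finset_sup]

theorem supIrred_of_le {T : Type*} [LinearOrder T] {a b : T} (ha : SupIrred a) (h : a ≤ b) :
    SupIrred b :=
  supIrred_iff_not_isMin.2 fun hb => ha.not_isMin (hb.mono h)

end LevelCorr

/-- The map `γ : E → T` enumerates the join-irreducible elements of `T` in decreasing order. -/
structure EnumeratesSupIrred {E T : Type*} [Preorder E] [SemilatticeSup T] (γ : E → T) : Prop where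
  strictAnti : StrictAnti γ
  range_eq : Set.range γ = {a | SupIrred a}

namespace EnumeratesSupIrred

section Semilattice

variable {E T : Type*} [SemilatticeSup T] {γ : E → T}

theorem supIrred [Preorder E] (hγ : EnumeratesSupIrred γ) (e : E) : SupIrred (γ e) :=
  hγ.range_eq.le ⟨e, rfl⟩

theorem coversSupIrred [Preorder E] (hγ : EnumeratesSupIrred γ) : CoversSupIrred γ :=
  hγ.range_eq.ge

theorem card_le [LinearOrder E] (hγ : EnumeratesSupIrred γ) :
    Nat.card E ≤ {a : T | SupIrred a}.ncard := by
  rw [← hγ.range_eq, ← Set.image_univ, Set.ncard_image_of_injective _ hγ.strictAnti.injective,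
    Set.ncard_univ]

end Semilattice

section Chain

variable {T : Type*} [LinearOrder T] {E : Type e} [LinearOrder E] {γ : E → T}

theorem comp_ofLE [OrderBot T] [Fintype E] (hγ : EnumeratesSupIrred γ) {X : Type*}
    (φ : Corr X E) :
    Corr.comp φ (OrderRel.ofLE E).rel = levelCorr γ (joinAct φ γ) := by
  ext ⟨x, f⟩
  refine Iff.trans ?_ (le_joinAct_apply_iff (supPrime_iff_supIrred.2 (hγ.supIrred f))).symm
  simp only [hγ.strictAnti.le_iff_ge]
  rfl

theorem inessential_levelCorr [Finite E] (hγ : EnumeratesSupIrred γ) {α : E → T}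
    (hα : ¬ CoversSupIrred α) : Inessential (levelCorr γ α) := by
  obtain ⟨a, ha, haα⟩ := Set.not_subset.1 hα
  obtain ⟨e₀, rfl⟩ := hγ.coversSupIrred ha
  let Y := {e : E // γ e ∈ Set.range α}
  have hY : Nat.card Y < Nat.card E := Finite.card_subtype_lt haα
  convert Inessential.of_card_lt hY {p : E × Y | γ p.2 ≤ α p.1} {p : Y × E | γ p.2 ≤ γ p.1}
  ext ⟨x, f⟩
  constructor
  · intro (h : γ f ≤ α x)
    obtain ⟨e, he⟩ := hγ.coversSupIrred (supIrred_of_le (hγ.supIrred f) h)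
    exact ⟨⟨e, x, he.symm⟩, he.le, h.trans he.ge⟩
  · rintro ⟨y, hxy, hyf⟩
    exact le_trans hyf hxy

end Chain

end EnumeratesSupIrred

theorem isMax_ofLE (E : Type e) [LinearOrder E] : IsMax (OrderRel.ofLE E) := by
  rintro S hS ⟨a, b⟩ hab
  refine (le_total a b).elim id fun hba => ?_
  exact (S.2.2.1 a b hab (hS (show (b, a) ∈ (OrderRel.ofLE E).1 from hba))).le

theorem fElement_eq_of_isMax (k : Type u) [CommRing k] {E : Type e} [Finite E] {R : OrderRel E}
    (hR : IsMax R) : fElement k R = permutedClass k E R.rel := by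
  classical
  have h : (Finset.univ.filter fun S : OrderRel E => R ≤ S) = {R} := by
    ext S
    simpa using ⟨fun h => (hR h).antisymm h, fun h => h ▸ le_rfl⟩
  rw [fElement, Finset.sum_congr (by convert h) fun _ _ => rfl, Finset.sum_singleton,
    IncidenceAlgebra.mu_self, one_smul]

theorem ofLE_comp_ofLE (E : Type e) [PartialOrder E] :
    Corr.comp (OrderRel.ofLE E).rel (OrderRel.ofLE E).rel = (OrderRel.ofLE E).rel := by
  ext ⟨a, b⟩
  exact ⟨fun ⟨_, hac, hcb⟩ => le_trans hac hcb, fun hab => ⟨b, hab, le_refl b⟩⟩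

theorem isIdempotentElem_fElement_ofLE (k : Type u) [CommRing k] (E : Type e) [LinearOrder E]
    [Finite E] : IsIdempotentElem (fElement k (OrderRel.ofLE E)) := by
  rw [fElement_eq_of_isMax k (isMax_ofLE E)]
  exact (map_mul (permutedClass k E) _ _).symm.trans (congrArg _ (ofLE_comp_ofLE E))

namespace EnumeratesSupIrred

variable (k : Type u) [CommRing k] {T : Type*} [LinearOrder T] {E : Type e} [LinearOrder E]
  {γ : E → T}

/-- The linear map `F_T(E) / H_T(E) → 𝒫_E` which sends the class of `α` to the class of
`levelCorr γ α`. -/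
noncomputable def levelHom [Finite E] (hγ : EnumeratesSupIrred γ) :
    LatticeQuot k T E →ₗ[k] PermutedOrders k E :=
  Submodule.liftQ _ (Finsupp.linearCombination k fun α => permutedClass k E (levelCorr γ α)) <| by
    rw [Finsupp.supported_eq_span_single, Submodule.span_le]
    rintro _ ⟨α, hα, rfl⟩
    simpa using permutedClass_eq_zero k (hγ.inessential_levelCorr hα)

theorem levelHom_of [Finite E] (hγ : EnumeratesSupIrred γ) (α : E → T) :
    hγ.levelHom k (.of k α) = permutedClass k E (levelCorr γ α) :=
  (Finsupp.linearCombination_single k 1 α).trans (one_smul k _)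

variable [Fintype E] [OrderBot T]

/-- The linear map `𝒫_E → F_T(E) / H_T(E)` given by the action on the class of `γ`. -/
noncomputable def orbitHom (hγ : EnumeratesSupIrred γ) :
    PermutedOrders k E →ₗ[k] LatticeQuot k T E :=
  (permutedRep k T hγ.card_le).toLinearMap.flip (.of k γ)

theorem orbitHom_permutedClass_mul (hγ : EnumeratesSupIrred γ) (Q : Corr E E)
    (a : PermutedOrders k E) :
    hγ.orbitHom k (permutedClass k E Q * a) = joinMap k T Q (hγ.orbitHom k a) := by
  simp [orbitHom, permutedRep_permutedClass]

theorem orbitHom_permutedClass (hγ : EnumeratesSupIrred γ) (Q : Corr E E) :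
    hγ.orbitHom k (permutedClass k E Q) = .of k (joinAct Q γ) := by
  simp [orbitHom, permutedRep_permutedClass, joinMap_of]

theorem levelHom_orbitHom (hγ : EnumeratesSupIrred γ) (a : PermutedOrders k E) :
    hγ.levelHom k (hγ.orbitHom k a) = a * fElement k (OrderRel.ofLE E) := by
  suffices h : hγ.levelHom k ∘ₗ hγ.orbitHom k =
      LinearMap.mulRight k (fElement k (OrderRel.ofLE E)) from LinearMap.congr_fun h a
  refine PermutedOrders.hom_ext fun Q => ?_
  rw [LinearMap.comp_apply, orbitHom_permutedClass, levelHom_of, ← hγ.comp_ofLE,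
    LinearMap.mulRight_apply, fElement_eq_of_isMax k (isMax_ofLE E)]
  exact map_mul (permutedClass k E) _ _

theorem orbitHom_levelHom [Finite T] (hγ : EnumeratesSupIrred γ) (m : LatticeQuot k T E) :
    hγ.orbitHom k (hγ.levelHom k m) = m := by
  suffices h : hγ.orbitHom k ∘ₗ hγ.levelHom k = LinearMap.id from LinearMap.congr_fun h m
  refine LatticeQuot.hom_ext fun α => ?_
  rw [LinearMap.comp_apply, levelHom_of, orbitHom_permutedClass,
    joinAct_levelCorr hγ.coversSupIrred, LinearMap.id_apply]

/-- The fundamental module of a finite chain is `F_T(E) / H_T(E)`, with `f_R` corresponding to the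
class of `γ`. -/
noncomputable def fundamentalEquiv [Finite T] (hγ : EnumeratesSupIrred γ) :
    fundamentalModule k (OrderRel.ofLE E) ≃ₗ[k] LatticeQuot k T E where
  toFun a := hγ.orbitHom k a
  map_add' a b := map_add (hγ.orbitHom k) (a : PermutedOrders k E) b
  map_smul' c a := map_smul (hγ.orbitHom k) c (a : PermutedOrders k E)
  invFun m := ⟨hγ.levelHom k m, Ideal.mem_span_singleton'.2
    ⟨hγ.levelHom k m, by rw [← hγ.levelHom_orbitHom k, hγ.orbitHom_levelHom k]⟩⟩
  left_inv a := by
    obtain ⟨b, hb⟩ := Ideal.mem_span_singleton'.1 a.2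
    ext
    change hγ.levelHom k (hγ.orbitHom k a) = a
    rw [levelHom_orbitHom, ← hb, mul_assoc, isIdempotentElem_fElement_ofLE]
  right_inv := hγ.orbitHom_levelHom k

theorem fundamentalEquiv_rep [Finite T] (hγ : EnumeratesSupIrred γ) (Q : Corr E E)
    (a : fundamentalModule k (OrderRel.ofLE E)) :
    hγ.fundamentalEquiv k (fundamentalRep k _ Q a) = joinMap k T Q (hγ.fundamentalEquiv k a) :=
  hγ.orbitHom_permutedClass_mul k Q a

theorem fundamentalEquiv_symm_joinMap [Finite T] (hγ : EnumeratesSupIrred γ) (Q : Corr E E)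
    (m : LatticeQuot k T E) :
    (hγ.fundamentalEquiv k).symm (joinMap k T Q m) =
      fundamentalRep k _ Q ((hγ.fundamentalEquiv k).symm m) := by
  rw [LinearEquiv.symm_apply_eq, fundamentalEquiv_rep, LinearEquiv.apply_symm_apply]

end EnumeratesSupIrred

section Separation

theorem exists_sum_mul_subset_eq_ite (k : Type*) [CommRing k] {X : Type*} [Fintype X]
    [DecidableEq X] (s : Finset X) :
    ∃ c : Finset X → k, ∀ D : Finset X,
      ∑ A, c A * (if A ⊆ D then 1 else 0) = if D = s then 1 else 0 := by
  refine ⟨fun A => if s ⊆ A then IncidenceAlgebra.mu k s A else 0, fun D => ?_⟩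
  simp only [eq_comm (a := D)]
  rw [← IncidenceAlgebra.sum_Icc_mu_right (𝕜 := k) s D, Finset.Icc_eq_filter_powerset,
    Finset.sum_filter]
  simp only [mul_ite, mul_one, mul_zero]
  rw [← Finset.sum_filter]
  exact Finset.sum_congr (by ext A; simp) fun _ _ => rfl

theorem eq_of_forall_lt_iff_or_le_iff {X T : Type*} [LinearOrder T] [WellFoundedGT T]
    {α β : X → T} (hβ : CoversSupIrred β)
    (h : ∀ a, SupIrred a → (∀ x, α x < a ↔ β x < a) ∨ ∀ x, α x ≤ a ↔ β x < a) : α = β := by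
  have lt_iff (a : T) (ha : SupIrred a) (x : X) : α x < a ↔ β x < a := by
    induction a using WellFoundedGT.induction generalizing x with
    | ind a ih =>
      refine (h a ha).elim (· x) fun hle => ?_
      obtain ⟨y, rfl⟩ := hβ ha
      have hy : β y < α y := not_le.1 (mt (hle y).1 (lt_irrefl _))
      exact absurd ((ih _ hy (supIrred_of_le ha hy.le) y).2 hy) (lt_irrefl _)
  have supIrred_of_lt {a b : T} (hab : a < b) : SupIrred b :=
    supIrred_iff_not_isMin.2 (not_isMin_of_lt hab)
  funext x
  refine le_antisymm (not_lt.1 fun hx => ?_) (not_lt.1 fun hx => ?_)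
  · exact lt_irrefl _ ((lt_iff _ (supIrred_of_lt hx) x).2 hx)
  · exact lt_irrefl _ ((lt_iff _ (supIrred_of_lt hx) x).1 hx)

variable (k : Type*) [CommRing k] {T : Type*} [LinearOrder T] [OrderBot T]
  {E X : Type*} [Fintype X]

open Classical in
theorem ite_sup_eq (A : Finset X) (α : X → T) {a : T} (ha : SupIrred a) :
    (if A.sup α = a then (1 : k) else 0) =
      (if A ⊆ Finset.univ.filter (α · ≤ a) then 1 else 0) -
        if A ⊆ Finset.univ.filter (α · < a) then 1 else 0 := by
  have hle : A ⊆ Finset.univ.filter (α · ≤ a) ↔ A.sup α ≤ a := by simp [Finset.subset_iff]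
  have hlt : A ⊆ Finset.univ.filter (α · < a) ↔ A.sup α < a := by
    simp [Finset.subset_iff, Finset.sup_lt_iff ha.ne_bot.bot_lt]
  simp only [hle, hlt]
  rcases lt_trichotomy (A.sup α) a with h | h | h
  · simp [h, h.le, h.ne]
  · simp [h]
  · simp [h.not_ge, h.not_gt, h.ne']

open Classical in
theorem exists_sum_mul_sup_eq (β : X → T) {a : T} (ha : SupIrred a) :
    ∃ c : Finset X → k, ∀ α : X → T,
      ∑ A, c A * (if A.sup α = a then 1 else 0) =
        (if ∀ x, α x < a ↔ β x < a then 1 else 0) - if ∀ x, α x ≤ a ↔ β x < a then 1 else 0 := by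
  obtain ⟨c, hc⟩ := exists_sum_mul_subset_eq_ite k (Finset.univ.filter (β · < a))
  refine ⟨-c, fun α => ?_⟩
  have hlt := hc (Finset.univ.filter (α · < a))
  have hle := hc (Finset.univ.filter (α · ≤ a))
  simp only [Finset.filter_inj', Finset.mem_univ, forall_true_left] at hlt hle
  rw [← hlt, ← hle, ← Finset.sum_sub_distrib]
  refine Finset.sum_congr rfl fun A _ => ?_
  rw [ite_sup_eq k A α ha, Pi.neg_apply]
  ring

open Classical in
theorem exists_sum_mul_joinAct_eq [WellFoundedGT T] [Fintype E] {γ : E → T}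
    (hγ : Set.range γ = {a | SupIrred a}) {β : X → T} (hβ : CoversSupIrred β) :
    ∃ d : (E → Finset X) → k, ∀ α : X → T,
      ∑ A, d A * (if joinAct (Corr.ofSections A) α = γ then 1 else 0) =
        if α = β then 1 else 0 := by
  have hirr (e : E) : SupIrred (γ e) := hγ.le ⟨e, rfl⟩
  choose c hc using fun e => exists_sum_mul_sup_eq k β (hirr e)
  refine ⟨fun A => ∏ e, c e (A e), fun α => ?_⟩
  have prod_ite (A : E → Finset X) :
      (if joinAct (Corr.ofSections A) α = γ then (1 : k) else 0) =
        ∏ e, if (A e).sup α = γ e then 1 else 0 := by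
    simp only [Finset.prod_boole, funext_iff, joinAct_ofSections, Finset.mem_univ,
      forall_true_left]
  simp only [prod_ite, ← Finset.prod_mul_distrib]
  rw [← Fintype.piFinset_univ, ← Finset.prod_univ_sum (fun _ => Finset.univ) fun e B =>
    c e B * if B.sup α = γ e then 1 else 0]
  simp only [hc]
  split_ifs with hα
  · subst hα
    refine Finset.prod_eq_one fun e _ => ?_
    obtain ⟨x, hx⟩ := hβ (hirr e)
    have hle : ¬ ∀ x, α x ≤ γ e ↔ α x < γ e := fun h => hx.not_lt ((h x).1 hx.le)
    rw [if_pos fun _ => Iff.rfl, if_neg hle, sub_zero]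
  · by_contra hne
    refine hα (eq_of_forall_lt_iff_or_le_iff hβ fun a ha => ?_)
    obtain ⟨e, rfl⟩ := hγ.ge ha
    by_contra h
    rw [not_or] at h
    exact hne (Finset.prod_eq_zero (Finset.mem_univ e) (by rw [if_neg h.1, if_neg h.2, sub_zero]))

variable {k}

theorem LatticeQuot.eq_zero_of_forall_joinMap_eq_zero [WellFoundedGT T] [Finite E] {γ : E → T}
    (hγ : Set.range γ = {a | SupIrred a}) {m : LatticeQuot k T X}
    (hm : ∀ ψ : Corr E X, joinMap k T ψ m = 0) : m = 0 := by
  classical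
  have := Fintype.ofFinite E
  refine (basis k T X).forall_coord_eq_zero_iff.1 fun β => ?_
  obtain ⟨d, hd⟩ := exists_sum_mul_joinAct_eq k hγ β.2
  have coord_eq : (basis k T X).coord β =
      ∑ A, d A • (basis k T E).coord ⟨γ, hγ.ge⟩ ∘ₗ joinMap k T (Corr.ofSections A) :=
    hom_ext fun α => by
      simp only [LinearMap.sum_apply, LinearMap.smul_apply, LinearMap.comp_apply, joinMap_of,
        basis_coord_of, smul_eq_mul]
      convert (hd α).symm
  simp [-Module.Basis.coord_apply, coord_eq, hm]

end Separation

section Counting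

theorem card_subset_range {T X : Type*} [Fintype T] [Fintype X] (A : Finset T) :
    (Nat.card {α : X → T // ↑A ⊆ Set.range α} : ℤ) = ∑ i ∈ Finset.range (A.card + 1),
      (-1 : ℤ) ^ (A.card - i) * (A.card.choose i : ℤ) *
        ((Fintype.card T - A.card + i : ℕ) : ℤ) ^ Fintype.card X := by
  classical
  let S : T → Finset (X → T) := fun a => {α | a ∉ Set.range α}
  have card_covering : Nat.card {α : X → T // ↑A ⊆ Set.range α} = (A.inf fun a => (S a)ᶜ).card := by
    rw [Nat.card_eq_fintype_card, Fintype.card_subtype]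
    congr 1
    ext α
    simp [Finset.mem_inf, S, Set.subset_def]
  have card_missing (t : Finset T) :
      (t.inf S).card = (Fintype.card T - t.card) ^ Fintype.card X := by
    have : t.inf S = Fintype.piFinset fun _ : X => tᶜ := by
      ext α
      simp only [Finset.mem_inf, S, Finset.mem_filter, Finset.mem_univ, true_and, Set.mem_range,
        not_exists, Fintype.mem_piFinset, Finset.mem_compl]
      exact ⟨fun h x hx => h _ hx x rfl, fun h a ha x hx => h x (hx ▸ ha)⟩
    rw [this, Fintype.card_piFinset, Finset.prod_const, Finset.card_compl, Finset.card_univ]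
  rw [card_covering, Finset.inclusion_exclusion_card_inf_compl]
  simp only [card_missing]
  rw [Finset.sum_powerset_apply_card
    (fun m => (-1 : ℤ) ^ m * (((Fintype.card T - m) ^ Fintype.card X : ℕ) : ℤ)),
    ← Finset.sum_range_reflect]
  refine Finset.sum_congr rfl fun i hi => ?_
  have hi : i ≤ A.card := Finset.mem_range_succ_iff.1 hi
  have hA : A.card ≤ Fintype.card T := A.card_le_univ
  rw [Nat.add_sub_cancel, Nat.choose_symm hi, tsub_tsub_assoc hA hi, nsmul_eq_mul]
  push_cast
  ring

theorem card_coversSupIrred_fin (n : ℕ) (X : Type*) [Fintype X] :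
    (Nat.card {α : X → Fin (n + 1) // CoversSupIrred α} : ℤ) = ∑ i ∈ Finset.range (n + 1),
      (-1 : ℤ) ^ (n - i) * (n.choose i : ℤ) * ((i : ℤ) + 1) ^ Fintype.card X := by
  have supIrred_eq : {a : Fin (n + 1) | SupIrred a} = ↑(Finset.univ.erase (0 : Fin (n + 1))) := by
    ext a
    simp [bot_eq_zero]
  simp only [CoversSupIrred, supIrred_eq]
  rw [card_subset_range]
  simp [add_comm]

end Counting

section LinearExtension

variable {k : Type u} [CommRing k]

theorem linearExtension_naturality {G G' : FinCorr.{w} ⥤ ModuleCat.{m} k} (τ : G ⟶ G')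
    {X Y : FinCorr.{w}} (a : Free.of k X ⟶ Free.of k Y) :
    (linearExtension G).obj.map a ≫ τ.app Y = τ.app X ≫ (linearExtension G').obj.map a := by
  suffices h : Linear.rightComp k (G.obj X) (τ.app Y) ∘ₗ Finsupp.linearCombination k G.map =
      Linear.leftComp k (G'.obj Y) (τ.app X) ∘ₗ Finsupp.linearCombination k G'.map from
    LinearMap.congr_fun h a
  refine Finsupp.lhom_ext' fun f => LinearMap.ext_ring ?_
  simp

/-- The isomorphism of correspondence functors extending an isomorphism of functors on `𝒞`. -/
noncomputable def linearExtensionIso {G G' : FinCorr.{w} ⥤ ModuleCat.{m} k} (i : G ≅ G') :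
    linearExtension G ≅ linearExtension G' :=
  ObjectProperty.isoMk _ <|
    NatIso.ofComponents (fun X => i.app X) (linearExtension_naturality i.hom)

end LinearExtension

section Recognition

variable {k : Type u} [CommRing k] {E : Type e} {W : Type t} [AddCommGroup W] [Module k W]
  {ρ : Representation k (Corr E E) W}

section Lift

variable {X : Type w} {M : Type*} [AddCommGroup M] [Module k M] (i : Corr X E → W →ₗ[k] M)
  (hi : ∀ φ Q w, i (Corr.comp φ Q) w = i φ (ρ Q w))

/-- The map `L_{E,W}(X) → M` with `φ ⊗ w ↦ i φ w`, for a balanced map `i`. -/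
noncomputable def LModuleLift : LModule ρ X →ₗ[k] M :=
  (balanced ρ X).liftQ (TensorProduct.lift (Finsupp.linearCombination k i).flip) <| by
    rw [balanced, Submodule.span_le]
    rintro _ ⟨φ, Q, w, rfl⟩
    simp [hi]

theorem LModuleLift_mk (w : W) (φ : Corr X E) :
    LModuleLift i hi (Submodule.Quotient.mk (w ⊗ₜ[k] Finsupp.single φ 1)) = i φ w := by
  change TensorProduct.lift (Finsupp.linearCombination k i).flip (w ⊗ₜ[k] Finsupp.single φ 1) = _
  simp

theorem LModuleLift_surjective (h : ⨆ φ, LinearMap.range (i φ) = ⊤) :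
    Function.Surjective (LModuleLift i hi) := by
  rw [← LinearMap.range_eq_top, ← top_le_iff, ← h, iSup_le_iff]
  rintro φ _ ⟨w, rfl⟩
  exact ⟨_, LModuleLift_mk i hi w φ⟩

theorem ker_LModuleLift (p : Corr E X → M →ₗ[k] W)
    (p_i : ∀ ψ φ w, p ψ (i φ w) = ρ (Corr.comp ψ φ) w)
    (eq_zero_of_p : ∀ v, (∀ ψ, p ψ v = 0) → v = 0) :
    LinearMap.ker (LModuleLift i hi) = JModule ρ X := by
  have p_lift (ψ : Corr E X) : p ψ ∘ₗ LModuleLift i hi = pairing ρ ψ :=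
    LModule_hom_ext ρ fun w φ => by
      rw [LinearMap.comp_apply, LModuleLift_mk, pairing_mk, p_i]
  ext z
  simp only [mem_JModule, ← p_lift, LinearMap.comp_apply]
  exact ⟨fun h ψ => by rw [LinearMap.mem_ker.1 h, map_zero], eq_zero_of_p _⟩

end Lift

theorem nonempty_linearExtension_iso_LJQuotient {G : FinCorr.{w} ⥤ ModuleCat.{max w (max e t) u} k}
    (i : ∀ X : FinCorr.{w}, Corr X E → W →ₗ[k] G.obj X)
    (p : ∀ X : FinCorr.{w}, Corr E X → G.obj X →ₗ[k] W)
    (map_i : ∀ {X Y : FinCorr.{w}} (Q : X ⟶ Y) (φ : Corr X E) (w : W),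
      (G.map Q).hom (i X φ w) = i Y (Corr.comp Q φ) w)
    (p_i : ∀ (X : FinCorr.{w}) (ψ : Corr E X) (φ : Corr X E) (w : W),
      p X ψ (i X φ w) = ρ (Corr.comp ψ φ) w)
    (iSup_range_i : ∀ X : FinCorr.{w}, ⨆ φ, LinearMap.range (i X φ) = ⊤)
    (eq_zero_of_p : ∀ (X : FinCorr.{w}) (v : G.obj X), (∀ ψ, p X ψ v = 0) → v = 0) :
    Nonempty (linearExtension G ≅ LJQuotient ρ) := by
  have hi (X : FinCorr.{w}) (φ : Corr X E) (Q : Corr E E) (w : W) :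
      i X (Corr.comp φ Q) w = i X φ (ρ Q w) := by
    refine sub_eq_zero.1 (eq_zero_of_p X _ fun ψ => ?_)
    rw [map_sub, p_i, p_i, ← Corr.comp_assoc, sub_eq_zero]
    exact LinearMap.congr_fun (map_mul ρ (Corr.comp ψ φ) Q) w
  let equiv (X : FinCorr.{w}) : (LModule ρ X ⧸ JModule ρ X) ≃ₗ[k] G.obj X :=
    (Submodule.quotEquivOfEq _ _
      (ker_LModuleLift _ (hi X) (p X) (p_i X) (eq_zero_of_p X)).symm).trans <|
    LinearMap.quotKerEquivOfSurjective _ (LModuleLift_surjective _ (hi X) (iSup_range_i X))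
  have lift_LMap {X Y : FinCorr.{w}} (Q : X ⟶ Y) :
      LModuleLift (i Y) (hi Y) ∘ₗ LMap ρ Q = (G.map Q).hom ∘ₗ LModuleLift (i X) (hi X) :=
    LModule_hom_ext ρ fun w φ => by
      simp only [LinearMap.comp_apply, LMap_mk, LModuleLift_mk, map_i]
  refine ⟨(linearExtensionIso <| NatIso.ofComponents (fun X => (equiv X).toModuleIso) ?_).symm⟩
  intro X Y Q
  ext z
  obtain ⟨z, rfl⟩ := Submodule.Quotient.mk_surjective _ z
  exact LinearMap.congr_fun (lift_LMap Q) z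

end Recognition

section LatticeFunctor

variable (k : Type u) [CommRing k] (T : Type t) [Lattice T] [OrderBot T]

/-- The functor `F_T / H_T` on the category `𝒞`, i.e. before `k`-linear extension. -/
noncomputable abbrev latticeQuotientFunctor : FinCorr.{w} ⥤ ModuleCat.{max w t u} k :=
  quotientFunctor (latticeFunctor k T) (latticeSub k T) (latticeSub_le k T)

theorem latticeSub_eq_supported (X : FinCorr.{w}) :
    latticeSub k T X = Finsupp.supported k k {α : X → T | ¬ CoversSupIrred α} := by
  rw [Finsupp.supported_eq_span_single, latticeSub]
  congr 1
  ext v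
  exact exists_congr fun φ => and_congr_right fun _ => eq_comm

/-- The identification of `F_T(X) / H_T(X)`, as defined through generators of `H_T(X)`, with
`LatticeQuot k T X`. -/
noncomputable def latticeQuotEquiv (X : FinCorr.{w}) :
    (latticeQuotientFunctor k T).obj X ≃ₗ[k] LatticeQuot k T X :=
  Submodule.quotEquivOfEq _ _ (latticeSub_eq_supported k T X)

theorem latticeQuotEquiv_map {X Y : FinCorr.{w}} (Q : X ⟶ Y)
    (v : (latticeQuotientFunctor k T).obj X) :
    latticeQuotEquiv k T Y (((latticeQuotientFunctor k T).map Q).hom v) =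
      joinMap k T Q (latticeQuotEquiv k T X v) := by
  obtain ⟨v, rfl⟩ := Submodule.Quotient.mk_surjective _ v
  rfl

theorem nonempty_basis_latticeQuotient [Finite T] (X : FinCorr.{w}) :
    Nonempty (Module.Basis (Fin (Nat.card {α : X → T // CoversSupIrred α})) k
      ((latticeQuotient k T).eval X)) :=
  ⟨((LatticeQuot.basis k T X).map (latticeQuotEquiv k T X).symm).reindex (Finite.equivFin _)⟩

end LatticeFunctor

theorem iSup_range_joinMap (k : Type*) [CommRing k] {T E X : Type*} [SemilatticeSup T] [OrderBot T]
    [WellFoundedLT T] [Fintype E] {γ : E → T} (hγ : CoversSupIrred γ) :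
    ⨆ φ : Corr X E, LinearMap.range (joinMap k T φ) = ⊤ := by
  rw [← Submodule.ker_mkQ (⨆ φ, _), LinearMap.ker_eq_top]
  refine LatticeQuot.hom_ext fun α => (Submodule.Quotient.mk_eq_zero _).2 ?_
  refine Submodule.mem_iSup_of_mem (levelCorr γ α) ⟨LatticeQuot.of k γ, ?_⟩
  rw [joinMap_of, joinAct_levelCorr hγ]

theorem nonempty_latticeQuotient_iso_fundamentalFunctor (k : Type u) [CommRing k] {T E : Type e}
    [LinearOrder T] [OrderBot T] [Finite T] [LinearOrder E] [Finite E] {γ : E → T}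
    (hγ : EnumeratesSupIrred γ) :
    Nonempty ((latticeQuotient k T : CorrespondenceFunctor.{u, w, max w e u} k) ≅
      fundamentalFunctor k (OrderRel.ofLE E)) := by
  have := Fintype.ofFinite E
  let f := hγ.fundamentalEquiv k
  let q (X : FinCorr.{w}) := latticeQuotEquiv k T X
  refine nonempty_linearExtension_iso_LJQuotient
    (fun X φ => (q X).symm ∘ₗ joinMap k T φ ∘ₗ f) (fun X ψ => f.symm ∘ₗ joinMap k T ψ ∘ₗ q X)
    ?_ ?_ ?_ ?_
  · intro X Y Q φ w
    refine (q Y).injective ((latticeQuotEquiv_map k T Q _).trans ?_)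
    simp only [LinearMap.comp_apply, LinearEquiv.coe_coe, LinearEquiv.apply_symm_apply, q,
      joinMap_comp]
  · intro X ψ φ w
    simp only [LinearMap.comp_apply, LinearEquiv.coe_coe, LinearEquiv.apply_symm_apply]
    rw [← LinearMap.comp_apply, ← joinMap_comp, hγ.fundamentalEquiv_symm_joinMap k,
      LinearEquiv.symm_apply_apply]
  · intro X
    simp only [LinearMap.range_comp, LinearEquiv.range, Submodule.map_top, ← Submodule.map_iSup,
      iSup_range_joinMap k hγ.coversSupIrred]
  · intro X v hv
    refine (q X).map_eq_zero_iff.1 (LatticeQuot.eq_zero_of_forall_joinMap_eq_zero hγ.range_eq ?_)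
    exact fun ψ => f.symm.map_eq_zero_iff.1 (hv ψ)

/-- The elements `n > ⋯ > 1` of `{0 < 1 < ⋯ < n}`, enumerated by `[n]` in decreasing order. -/
def revIcc (n : ℕ) (e : Set.Icc 1 n) : Fin (n + 1) :=
  ⟨n + 1 - e, by have := e.2.1; omega⟩

theorem enumeratesSupIrred_revIcc (n : ℕ) : EnumeratesSupIrred (revIcc n) where
  strictAnti e f (hef : (e : ℕ) < f) := by
    have := f.2.2
    simp only [revIcc, Fin.lt_def]
    omega
  range_eq := by
    ext a
    rw [Set.mem_ofPred_eq, supIrred_iff_not_isMin, isMin_iff_eq_bot, bot_eq_zero, Fin.ext_iff]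
    constructor
    · rintro ⟨e, rfl⟩
      have := e.2.2
      simp only [revIcc, Fin.val_zero]
      omega
    · intro (ha : (a : ℕ) ≠ 0)
      refine ⟨⟨n + 1 - a, by simp only [Set.mem_Icc]; omega⟩, Fin.ext ?_⟩
      simp only [revIcc]
      omega

end CorrFun

theorem mainTheorem12 {k : Type u} [CommRing k] (n : ℕ) :
    Nonempty ((CorrFun.totalS k n : CorrFun.CorrespondenceFunctor.{u, w, max w u} k) ≅
      CorrFun.fundamentalFunctor k (CorrFun.totalOrder n)) ∧
    ∀ X : CorrFun.FinCorr.{w}, ∃ r : ℕ,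
      (r : ℤ) = ∑ i ∈ Finset.range (n + 1),
        (-1 : ℤ) ^ (n - i) * (n.choose i : ℤ) * ((i : ℤ) + 1) ^ Fintype.card X ∧
      Nonempty (Module.Basis (Fin r) k ((CorrFun.totalS k n).eval X)) :=
  ⟨CorrFun.nonempty_latticeQuotient_iso_fundamentalFunctor k (CorrFun.enumeratesSupIrred_revIcc n),
    fun X => ⟨_, CorrFun.card_coversSupIrred_fin n X,
      CorrFun.nonempty_basis_latticeQuotient k (Fin (n + 1)) X⟩⟩
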